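/- Let $\Bbbk$ be an algebraically closed field of characteristic zero, $n\ge 1$, $R=\Bbbk[x_1,\dots,x_n]$, $R_{\le d}\subseteq R$ the polynomials of degree at most $d$, and let $R^*$, $R_{\le d}^*$ be the $\Bbbk$-linear duals. Let $d\ge 0$, let $F\in\Bbbk[x_0,\dots,x_n]$ be a form of degree $d$ (possibly zero), and let $f(x_1,\dots,x_n)=F(1,x_1,\dots,x_n)=\sum_\alpha f_\alpha x^\alpha$. Let $f^*\in R_{\le d}^*$ be the functional $f^*\big(\sum_\alpha g_\alpha x^\alpha\big)=\sum_{|\alpha|\le d} f_\alpha g_\alpha/\binom d\alpha$, where $\binom d\alpha=\frac{d!}{\alpha!\,(d-|\alpha|)!}$. For $\Lambda\in R^*$ put $I_\Lambda=\{g\in R:\Lambda(gh)=0\ \text{for all } h\in R\}$ and $\mathcal A_\Lambda=R/I_\Lambda$, and let $M_{x_j}^t$ be the operator $\varphi\mapsto\varphi(x_j\,\cdot\,)$ on $\mathcal A_\Lambda^*$. For $\zeta\in\Bbbk^n$ let $\mathbb 1_\zeta\in R^*$ be evaluation at $\zeta$, and for $p\in R$ let $p(\partial)$ be the differential operator obtained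 by substituting $\partial/\partial x_j$ for $x_j$. A *generalized decomposition* of $\Lambda$ is an expression $\Lambda=\sum_{i=1}^s \mathbb 1_{\zeta_i}\circ p_i(\partial)$, with distinct points $\zeta_i\in\Bbbk^n$ and $p_i\in R$, for which $\sum_{i=1}^s\dim_{\Bbbk}\big\langle \mathbb 1_{\zeta_i}\circ(\partial^\alpha p_i)(\partial):\alpha\in\mathbb N^n\big\rangle$ is minimal among all such expressions of $\Lambda$. For an eigenvalue candidate $\mu\in\Bbbk$ let $V^j[\mu]\subseteq\mathcal A_\Lambda^*$ be the generalized eigenspace of $M_{x_j}^t$ for $\mu$; a vector $v$ is a generalized eigenvector of rank $m\ge1$ of $M_{x_j}^t$ for $\mu$ if $(M_{x_j}^t-\mu)^m v=0\neq (M_{x_j}^t-\mu)^{m-1}v$. Let $m_i$ be the highest rank of the common generalized eigenvectors at $\zeta_i$, that is, the supremum, over $v\in\bigcap_{j=1}^n V^j[(\zeta_i)_j]$, $v\ne0$, and $j=1,\dots,n$, of the rank of $v$ as a generalized eigenvector of $M_{x_j}^t$ for $(\zeta_i)_j$ (with $m_i=0$ if there is no such $v$). Suppose that $\Lambda\in R^*$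 extends $f^*$, i.e. $\Lambda|_{R_{\le d}}=f^*$, and that $\Lambda=\sum_{i=1}^s\mathbb 1_{\zeta_i}\circ p_i(\partial)$ is a generalized decomposition. Put $L_i=x_0+(\zeta_i)_1x_1+\cdots+(\zeta_i)_nx_n$. Then for all integers $k_1,\dots,k_s$ with $k_i\ge\deg p_i+1$ (where $\deg 0:=0$) one has $k_i\ge m_i$ for every $i$, and there are forms $N_i\in\Bbbk[x_0,\dots,x_n]$ of degree $k_i-1$ (possibly zero) such that $$F=\sum_{i=1}^s L_i^{\,d-k_i+1}N_i .$$ If $k_i>d+1$, so that the exponent is negative, then moreover $N_i$ is divisible by $L_i^{\,k_i-1-d}$, so that every summand is a form of degree $d$; the identity is read in the field of rational functions. -/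

import Mathlib

open MvPolynomial

noncomputable section

namespace CactusDecomp

variable {K : Type*} [Field K] {n : ℕ}

/-- The differential monomial `∂^α = ∂_1^{α_1} ∘ ⋯ ∘ ∂_n^{α_n}` on `K[x_1, …, x_n]`. -/
def partialMonomial (α : Fin n →₀ ℕ) : Module.End K (MvPolynomial (Fin n) K) :=
  ((List.finRange n).map
    (fun i => ((pderiv i).toLinearMap : Module.End K (MvPolynomial (Fin n) K)) ^ α i)).prod

/-- The differential polynomial `p(∂)`, obtained from `p` by substituting `∂_i` for `x_i`. -/
def diffOp (p : MvPolynomial (Fin n) K) : Module.End K (MvPolynomial (Fin n) K) :=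
  ∑ α ∈ p.support, coeff α p • partialMonomial α

/-- The functional `𝟙_ζ ∘ p(∂)`: apply `p(∂)`, then evaluate at the point `ζ`. -/
def evalDiff (ζ : Fin n → K) (p : MvPolynomial (Fin n) K) :
    Module.Dual K (MvPolynomial (Fin n) K) :=
  (aeval ζ).toLinearMap ∘ₗ diffOp p

/-- The Hankel operator `f ↦ f ⋆ Λ = (g ↦ Λ (f g))`. -/
def hankel (Λ : Module.Dual K (MvPolynomial (Fin n) K)) :
    MvPolynomial (Fin n) K →ₗ[K] Module.Dual K (MvPolynomial (Fin n) K) :=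
  (LinearMap.mul K (MvPolynomial (Fin n) K)).compr₂ Λ

/-- The kernel `I_Λ` of the Hankel operator, as an ideal. -/
def hankelIdeal (Λ : Module.Dual K (MvPolynomial (Fin n) K)) : Ideal (MvPolynomial (Fin n) K) where
  carrier := {f | hankel Λ f = 0}
  zero_mem' := map_zero _
  add_mem' := by
    intro a b ha hb
    have ha' : hankel Λ a = 0 := ha
    have hb' : hankel Λ b = 0 := hb
    change hankel Λ (a + b) = 0
    rw [map_add, ha', hb', add_zero]
  smul_mem' := by
    intro c f hf
    have hf' : hankel Λ f = 0 := hf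
    change hankel Λ (c • f) = 0
    refine LinearMap.ext fun g => ?_
    have h : hankel Λ f (c * g) = 0 := by rw [hf']; rfl
    change Λ (c * f * g) = 0
    change Λ (f * (c * g)) = 0 at h
    rw [← h]
    congr 1
    ring

/-- The quotient algebra `A_Λ = R / I_Λ`. -/
abbrev QuotAlg (Λ : Module.Dual K (MvPolynomial (Fin n) K)) : Type _ :=
  MvPolynomial (Fin n) K ⧸ hankelIdeal Λ

/-- The transposed multiplication operator `M_{x_j}^t : φ ↦ (b ↦ φ (x_j b))` on `A_Λ^*`. -/
def mulTranspose (Λ : Module.Dual K (MvPolynomial (Fin n) K)) (j : Fin n) :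
    Module.End K (Module.Dual K (QuotAlg Λ)) :=
  (LinearMap.mulLeft K (Ideal.Quotient.mk (hankelIdeal Λ) (X j))).dualMap

/-- `v` is a generalized eigenvector of rank `m ≥ 1` of `T` for the eigenvalue `μ`. -/
def IsGenEigenvectorOfRank {V : Type*} [AddCommGroup V] [Module K V]
    (T : Module.End K V) (μ : K) (m : ℕ) (v : V) : Prop :=
  1 ≤ m ∧ ((T - algebraMap K (Module.End K V) μ) ^ m) v = 0 ∧
    ((T - algebraMap K (Module.End K V) μ) ^ (m - 1)) v ≠ 0

/-- The space `⋂_j V^j[ζ_j]`, where `V^j[μ]` is the generalized eigenspace of `M_{x_j}^t`. -/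
def commonGenEigenspace (Λ : Module.Dual K (MvPolynomial (Fin n) K)) (ζ : Fin n → K) :
    Submodule K (Module.Dual K (QuotAlg Λ)) :=
  ⨅ j, (mulTranspose Λ j).maxGenEigenspace (ζ j)

/-- The highest rank of the common generalized eigenvectors at `ζ`: the supremum, over
`v ∈ ⋂_j V^j[ζ_j]` and over `j`, of the rank of `v` as a generalized eigenvector of `M_{x_j}^t`.
It is taken in `ℕ∞`, so no boundedness is presupposed. -/
def highestRank (Λ : Module.Dual K (MvPolynomial (Fin n) K)) (ζ : Fin n → K) : ℕ∞ :=
  sSup {r : ℕ∞ | ∃ m : ℕ, r = m ∧ ∃ v ∈ commonGenEigenspace Λ ζ, ∃ j,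
    IsGenEigenvectorOfRank (mulTranspose Λ j) (ζ j) m v}

/-- `Λ = ∑ᵢ 𝟙_{ζᵢ} ∘ pᵢ(∂)` with distinct points `ζᵢ`. -/
structure IsPointDecomposition (Λ : Module.Dual K (MvPolynomial (Fin n) K)) {s : ℕ}
    (ζ : Fin s → Fin n → K) (p : Fin s → MvPolynomial (Fin n) K) : Prop where
  distinct : Function.Injective ζ
  eq_sum : Λ = ∑ i, evalDiff (ζ i) (p i)

/-- The multiplicity of `ζ` in a summand `𝟙_ζ ∘ p(∂)`: the dimension of the span of all
`𝟙_ζ ∘ (∂^α p)(∂)`. -/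
def multiplicity (ζ : Fin n → K) (p : MvPolynomial (Fin n) K) : ℕ :=
  Module.finrank K
    (Submodule.span K (Set.range fun α : Fin n →₀ ℕ => evalDiff ζ (partialMonomial α p)))

/-- A generalized decomposition of `Λ`: a decomposition whose size (the sum of the multiplicities)
is minimal among all decompositions of `Λ`. -/
structure IsGeneralizedDecomposition (Λ : Module.Dual K (MvPolynomial (Fin n) K)) {s : ℕ}
    (ζ : Fin s → Fin n → K) (p : Fin s → MvPolynomial (Fin n) K) : Prop where
  isPointDecomposition : IsPointDecomposition Λ ζ p
  minimal : ∀ (t : ℕ) (η : Fin t → Fin n → K) (q : Fin t → MvPolynomial (Fin n) K),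
    IsPointDecomposition Λ η q → ∑ i, multiplicity (ζ i) (p i) ≤ ∑ i, multiplicity (η i) (q i)

/-- The (multinomial) coefficient `d! / (α! (d - |α|)!)`, for `|α| ≤ d`, as an element of `K`. -/
def multiBinom (d : ℕ) (α : Fin n →₀ ℕ) : K :=
  (d.factorial : K) / ((∏ i, ((α i).factorial : K)) * ((d - α.degree).factorial : K))

/-- The dual polynomial `f^*` of `f ∈ R_{≤ d}`: the functional `g ↦ ∑_α f_α g_α / binom(d, α)`
on `R_{≤ d}`. -/
def dualPoly (d : ℕ) (f : MvPolynomial (Fin n) K) :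
    Module.Dual K (restrictTotalDegree (Fin n) K d) :=
  (∑ α ∈ f.support, (coeff α f / multiBinom d α) • lcoeff K α) ∘ₗ
    (restrictTotalDegree (Fin n) K d).subtype

/-- The dehomogenization `f(x_1, …, x_n) = F(1, x_1, …, x_n)`. -/
def dehomogenize (F : MvPolynomial (Fin (n + 1)) K) : MvPolynomial (Fin n) K :=
  aeval (Fin.cons 1 X : Fin (n + 1) → MvPolynomial (Fin n) K) F

/-- `Λ` extends a functional on `R_{≤ d}`. -/
def Extends (d : ℕ) (Λ : Module.Dual K (MvPolynomial (Fin n) K))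
    (φ : Module.Dual K (restrictTotalDegree (Fin n) K d)) : Prop :=
  Λ ∘ₗ (restrictTotalDegree (Fin n) K d).subtype = φ

/-- The linear form `x_0 + ζ_1 x_1 + ⋯ + ζ_n x_n`. -/
def linForm (ζ : Fin n → K) : MvPolynomial (Fin (n + 1)) K :=
  X 0 + ∑ j : Fin n, C (ζ j) * X j.succ

end CactusDecomp

end

/-! Two independent arguments. For the ranks: `𝟙_ζ ∘ p(∂)` kills the `k`-th power of the maximal
ideal of `ζ` once `k > deg p`, so `∏ pointIdeal (ζ i) ^ k i` lies in `I_Λ`. A common generalized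
eigenvector at `ζ i` is killed by some power of `pointIdeal (ζ i)`; since distinct points give
coprime ideals, it is already killed by the `k i`-th power
(`pointIdeal_pow_le_dualAnnihilatorIdeal`).

For the identity: apply `Λ`, acting on `y`, to `(x_0 + y_1 x_1 + ⋯ + y_n x_n)^d`. The multinomial
coefficients cancel the denominators of `f^*`, so the result is `F` (`formOf_eq_of_extends`). On a
summand, each `∂_i` in `y` brings down a factor `x_i` and lowers the exponent, so `𝟙_ζ ∘ ∂^α` yields
`d(d-1)⋯(d-|α|+1) x^α L^(d-|α|)` (`formOf_evalDiff`). Extracting `L^(d-k+1)` leaves the numerator.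
-/

namespace CactusDecomp

variable {K : Type*} [Field K] {n : ℕ}

/-! ### Ranks of common generalized eigenvectors -/

/-- The maximal ideal of the point `ζ`. -/
noncomputable def pointIdeal (ζ : Fin n → K) : Ideal (MvPolynomial (Fin n) K) :=
  Ideal.span (Set.range fun j => X j - C (ζ j))

theorem aeval_eq_zero_of_mem_pointIdeal {ζ : Fin n → K} {g : MvPolynomial (Fin n) K}
    (hg : g ∈ pointIdeal ζ) : aeval ζ g = 0 := by
  have h : pointIdeal ζ ≤ RingHom.ker (aeval ζ : MvPolynomial (Fin n) K →ₐ[K] K) := by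
    refine Ideal.span_le.2 ?_
    rintro _ ⟨j, rfl⟩
    simp
  exact h hg

theorem isCoprime_pointIdeal {ζ η : Fin n → K} (h : ζ ≠ η) :
    IsCoprime (pointIdeal ζ) (pointIdeal η) := by
  obtain ⟨j, hj⟩ := Function.ne_iff.1 h
  have hu : IsUnit (C (η j - ζ j) : MvPolynomial (Fin n) K) :=
    (IsUnit.mk0 _ (sub_ne_zero.2 hj.symm)).map C
  rw [Ideal.isCoprime_iff_sup_eq]
  refine Ideal.eq_top_of_isUnit_mem _ ?_ hu
  have e : (C (η j - ζ j) : MvPolynomial (Fin n) K)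
      = (X j - C (ζ j)) - (X j - C (η j)) := by
    rw [C_sub]; ring
  rw [e]
  exact sub_mem (Ideal.mem_sup_left (Ideal.subset_span ⟨j, rfl⟩))
    (Ideal.mem_sup_right (Ideal.subset_span ⟨j, rfl⟩))

/-- By the Leibniz rule, differentiating a product spoils at most one factor. -/
theorem derivation_mem_pow {R A : Type*} [CommRing R] [CommRing A] [Algebra R A]
    (D : Derivation R A A) (I : Ideal A) (m : ℕ) {g : A} (hg : g ∈ I ^ (m + 1)) :
    D g ∈ I ^ m := by
  induction m generalizing g with
  | zero => simp
  | succ m ih =>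
    rw [pow_succ] at hg
    refine Submodule.mul_induction_on hg (fun a ha b hb => ?_) fun a b ha hb => ?_
    · rw [D.leibniz, smul_eq_mul, smul_eq_mul]
      refine add_mem (Ideal.mul_mem_right _ _ ha) ?_
      rw [pow_succ']
      exact Ideal.mul_mem_mul hb (ih ha)
    · rw [map_add]
      exact add_mem ha hb

theorem pderiv_pow_mem_pow (I : Ideal (MvPolynomial (Fin n) K)) (i : Fin n) (a m : ℕ)
    {g : MvPolynomial (Fin n) K} (hg : g ∈ I ^ (m + a)) :
    (((pderiv i).toLinearMap : Module.End K (MvPolynomial (Fin n) K)) ^ a) g ∈ I ^ m := by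
  induction a generalizing g with
  | zero => simpa using hg
  | succ a ih =>
    rw [pow_succ, Module.End.mul_apply]
    exact ih (derivation_mem_pow (pderiv i) I (m + a) hg)

theorem listProd_pderiv_mem_pow (I : Ideal (MvPolynomial (Fin n) K)) (α : Fin n →₀ ℕ)
    (l : List (Fin n)) (m : ℕ) {g : MvPolynomial (Fin n) K}
    (hg : g ∈ I ^ (m + (l.map α).sum)) :
    (l.map fun i => ((pderiv i).toLinearMap :
      Module.End K (MvPolynomial (Fin n) K)) ^ α i).prod g ∈ I ^ m := by
  induction l generalizing m with
  | nil => simpa using hg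
  | cons i l ih =>
    rw [List.map_cons, List.prod_cons, Module.End.mul_apply]
    refine pderiv_pow_mem_pow I i _ m (ih _ ?_)
    rwa [List.map_cons, List.sum_cons, ← add_assoc] at hg

theorem sum_map_finRange (α : Fin n →₀ ℕ) : ((List.finRange n).map α).sum = α.degree := by
  rw [← List.ofFn_eq_map, List.sum_ofFn, Finsupp.degree_eq_sum]

/-- A derivative of order at most `deg p < k` leaves at least one factor that vanishes at `ζ`. -/
theorem evalDiff_eq_zero_of_mem_pow {ζ : Fin n → K} {p g : MvPolynomial (Fin n) K} {k : ℕ}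
    (hk : p.totalDegree + 1 ≤ k) (hg : g ∈ pointIdeal ζ ^ k) : evalDiff ζ p g = 0 := by
  simp only [evalDiff, diffOp, LinearMap.comp_apply, LinearMap.sum_apply, LinearMap.smul_apply,
    map_sum, map_smul]
  refine Finset.sum_eq_zero fun α hα => ?_
  have hd : 1 + α.degree ≤ k := by
    have := le_totalDegree hα
    change α.degree ≤ _ at this
    omega
  have h : partialMonomial α g ∈ pointIdeal ζ ^ 1 := by
    refine listProd_pderiv_mem_pow _ α _ 1 ?_
    rw [sum_map_finRange]
    exact Ideal.pow_le_pow_right hd hg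
  rw [pow_one] at h
  rw [AlgHom.toLinearMap_apply, aeval_eq_zero_of_mem_pointIdeal h, smul_zero]

theorem prod_pointIdeal_pow_le_hankelIdeal {Λ : Module.Dual K (MvPolynomial (Fin n) K)} {s : ℕ}
    {ζ : Fin s → Fin n → K} {p : Fin s → MvPolynomial (Fin n) K}
    (h : Λ = ∑ i, evalDiff (ζ i) (p i)) {k : Fin s → ℕ}
    (hk : ∀ i, (p i).totalDegree + 1 ≤ k i) :
    ∏ i, pointIdeal (ζ i) ^ k i ≤ hankelIdeal Λ := by
  intro g hg
  change hankel Λ g = 0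
  refine LinearMap.ext fun q => ?_
  change Λ (g * q) = 0
  rw [h, LinearMap.sum_apply]
  refine Finset.sum_eq_zero fun i _ => evalDiff_eq_zero_of_mem_pow (hk i) ?_
  exact Ideal.mul_mem_right _ _ (Ideal.prod_le_inf.trans (Finset.inf_le (Finset.mem_univ i)) hg)

theorem mulTranspose_sub_pow_apply (Λ : Module.Dual K (MvPolynomial (Fin n) K)) (j : Fin n)
    (μ : K) (m : ℕ) (v : Module.Dual K (QuotAlg Λ)) (g : MvPolynomial (Fin n) K) :
    ((mulTranspose Λ j - algebraMap K _ μ) ^ m) v (Ideal.Quotient.mk _ g) =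
      v (Ideal.Quotient.mk _ ((X j - C μ) ^ m * g)) := by
  induction m generalizing v with
  | zero => simp
  | succ m ih =>
    rw [pow_succ, Module.End.mul_apply, ih]
    have e : (X j - C μ) ^ (m + 1) * g
        = X j * ((X j - C μ) ^ m * g) - μ • ((X j - C μ) ^ m * g) := by
      rw [smul_eq_C_mul]; ring
    rw [e, map_sub, map_sub, LinearMap.sub_apply, LinearMap.sub_apply,
      map_mul (Ideal.Quotient.mk _) (X j)]
    congr 1
    exact (v.map_smul μ (Ideal.Quotient.mk _ ((X j - C μ) ^ m * g))).symm

/-- The annihilator of a functional on `A_Λ`. -/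
noncomputable def dualAnnihilatorIdeal {Λ : Module.Dual K (MvPolynomial (Fin n) K)}
    (v : Module.Dual K (QuotAlg Λ)) : Ideal (MvPolynomial (Fin n) K) :=
  hankelIdeal (v ∘ₗ (Ideal.Quotient.mkₐ K (hankelIdeal Λ)).toLinearMap)

theorem mem_dualAnnihilatorIdeal {Λ : Module.Dual K (MvPolynomial (Fin n) K)}
    {v : Module.Dual K (QuotAlg Λ)} {g : MvPolynomial (Fin n) K} :
    g ∈ dualAnnihilatorIdeal v ↔ ∀ q, v (Ideal.Quotient.mk _ (g * q)) = 0 :=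
  LinearMap.ext_iff

/-- Turns statements about ranks into ideal membership, where coprimality can be used. -/
theorem pow_mem_dualAnnihilatorIdeal_iff {Λ : Module.Dual K (MvPolynomial (Fin n) K)}
    {v : Module.Dual K (QuotAlg Λ)} {j : Fin n} {μ : K} {m : ℕ} :
    (X j - C μ) ^ m ∈ dualAnnihilatorIdeal v ↔
      ((mulTranspose Λ j - algebraMap K _ μ) ^ m) v = 0 := by
  rw [mem_dualAnnihilatorIdeal, LinearMap.ext_iff, Ideal.Quotient.mk_surjective.forall]
  simp only [mulTranspose_sub_pow_apply, LinearMap.zero_apply]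

theorem pointIdeal_pow_le_dualAnnihilatorIdeal {Λ : Module.Dual K (MvPolynomial (Fin n) K)}
    {s : ℕ} {ζ : Fin s → Fin n → K} {p : Fin s → MvPolynomial (Fin n) K}
    (h : IsPointDecomposition Λ ζ p) {k : Fin s → ℕ} (hk : ∀ i, (p i).totalDegree + 1 ≤ k i)
    (i : Fin s) {v : Module.Dual K (QuotAlg Λ)} (hv : v ∈ commonGenEigenspace Λ (ζ i)) :
    pointIdeal (ζ i) ^ k i ≤ dualAnnihilatorIdeal v := by
  -- Each of the finitely many generators has a power killing `v`, hence so does some power of the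
  -- ideal; `N` is not yet bounded by `k i`.
  obtain ⟨N, hN⟩ : ∃ N, pointIdeal (ζ i) ^ N ≤ dualAnnihilatorIdeal v := by
    refine Ideal.exists_pow_le_of_le_radical_of_fg (Ideal.span_le.2 ?_)
      (IsNoetherian.noetherian _)
    rintro _ ⟨j, rfl⟩
    obtain ⟨m, hm⟩ := (Module.End.mem_maxGenEigenspace _ _ _).1 ((Submodule.mem_iInf _).1 hv j)
    exact ⟨m, pow_mem_dualAnnihilatorIdeal_iff.2 hm⟩
  have hco : IsCoprime (∏ l ∈ Finset.univ.erase i, pointIdeal (ζ l) ^ k l)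
      (pointIdeal (ζ i) ^ N) :=
    IsCoprime.prod_left fun l hl => (isCoprime_pointIdeal
      (h.distinct.ne (Finset.ne_of_mem_erase hl))).pow
  obtain ⟨a, ha, b, hb, hab⟩ := Ideal.isCoprime_iff_exists.1 hco
  intro g hg
  -- `g * a` lies in `I_Λ`, so it acts as zero on `v`; `b` kills `v` by the choice of `N`.
  have e : g = g * a + b * g := by rw [mul_comm b, ← mul_add, hab, mul_one]
  rw [e]
  refine add_mem (mem_dualAnnihilatorIdeal.2 fun q => ?_) (Ideal.mul_mem_right _ _ (hN hb))
  have hga : g * a ∈ hankelIdeal Λ := by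
    refine prod_pointIdeal_pow_le_hankelIdeal h.eq_sum hk ?_
    rw [← Finset.mul_prod_erase _ _ (Finset.mem_univ i)]
    exact Ideal.mul_mem_mul hg ha
  rw [Ideal.Quotient.eq_zero_iff_mem.2 (Ideal.mul_mem_right q _ hga), map_zero]

theorem highestRank_le {Λ : Module.Dual K (MvPolynomial (Fin n) K)}
    {s : ℕ} {ζ : Fin s → Fin n → K} {p : Fin s → MvPolynomial (Fin n) K}
    (h : IsPointDecomposition Λ ζ p) {k : Fin s → ℕ} (hk : ∀ i, (p i).totalDegree + 1 ≤ k i)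
    (i : Fin s) : highestRank Λ (ζ i) ≤ k i := by
  refine sSup_le ?_
  rintro _ ⟨m, rfl, v, hv, j, -, -, hne⟩
  by_contra! hlt
  have hle : k i ≤ m - 1 := by
    have := Nat.cast_lt.1 hlt
    omega
  have hX : X j - C (ζ i j) ∈ pointIdeal (ζ i) := Ideal.subset_span ⟨j, rfl⟩
  exact hne (pow_mem_dualAnnihilatorIdeal_iff.1 (pointIdeal_pow_le_dualAnnihilatorIdeal h hk i hv
    (Ideal.pow_le_pow_right hle (Ideal.pow_mem_pow hX _))))

/-! ### The form attached to a functional -/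

/-- The extension of a functional on `K[y_1, …, y_n]` to polynomials in `y` with coefficients in
`K[x_0, …, x_n]`. -/
noncomputable def extendScalars : Module.Dual K (MvPolynomial (Fin n) K) →ₗ[K]
    (MvPolynomial (Fin n) (MvPolynomial (Fin (n + 1)) K) →ₗ[MvPolynomial (Fin (n + 1)) K]
      MvPolynomial (Fin (n + 1)) K) where
  toFun Λ := (basisMonomials (Fin n) (MvPolynomial (Fin (n + 1)) K)).constr K
    fun β => C (Λ (monomial β 1))
  map_add' Λ Λ' := by
    rw [← map_add]
    congr 1
    ext1 β
    simp
  map_smul' c Λ := by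
    rw [RingHom.id_apply, ← map_smul]
    congr 1
    ext1 β
    simp [smul_eq_C_mul]

theorem extendScalars_monomial (Λ : Module.Dual K (MvPolynomial (Fin n) K)) (β : Fin n →₀ ℕ)
    (a : MvPolynomial (Fin (n + 1)) K) :
    extendScalars Λ (monomial β a) = a * C (Λ (monomial β 1)) := by
  have h : monomial β a = a • basisMonomials (Fin n) (MvPolynomial (Fin (n + 1)) K) β := by
    rw [coe_basisMonomials, smul_monomial, smul_eq_mul, mul_one]
  rw [h, map_smul, smul_eq_mul]
  congr 1
  exact Module.Basis.constr_basis (basisMonomials (Fin n) (MvPolynomial (Fin (n + 1)) K)) K _ β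

theorem extendScalars_aeval (ζ : Fin n → K) :
    extendScalars (aeval ζ).toLinearMap =
      (aeval fun j => C (ζ j) : MvPolynomial (Fin n) (MvPolynomial (Fin (n + 1)) K) →ₐ[_]
        MvPolynomial (Fin (n + 1)) K).toLinearMap := by
  refine LinearMap.ext fun g => ?_
  induction g using MvPolynomial.induction_on' with
  | monomial β a =>
    rw [extendScalars_monomial]
    simp [aeval_monomial, Finsupp.prod, map_prod]
  | add g h hg hh => rw [map_add, map_add, hg, hh]

theorem extendScalars_comp_pderiv (Λ : Module.Dual K (MvPolynomial (Fin n) K)) (i : Fin n)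
    (g : MvPolynomial (Fin n) (MvPolynomial (Fin (n + 1)) K)) :
    extendScalars (Λ ∘ₗ (pderiv i).toLinearMap) g = extendScalars Λ (pderiv i g) := by
  induction g using MvPolynomial.induction_on' with
  | monomial β a =>
    have h : monomial (β - Finsupp.single i 1) (β i : K) =
        (β i : K) • monomial (β - Finsupp.single i 1) 1 := by
      rw [smul_monomial, smul_eq_mul, mul_one]
    rw [pderiv_monomial, extendScalars_monomial, extendScalars_monomial, LinearMap.comp_apply,
      Derivation.coeFn_coe, pderiv_monomial, one_mul, h, map_smul, smul_eq_mul, C_mul, map_natCast,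
      mul_assoc]
  | add g h hg hh => rw [map_add, map_add, map_add, hg, hh]

/-- The generic linear form `x_0 + y_1 x_1 + ⋯ + y_n x_n`. -/
noncomputable def genericForm (K : Type*) [Field K] (n : ℕ) :
    MvPolynomial (Fin n) (MvPolynomial (Fin (n + 1)) K) :=
  ∑ j : Fin (n + 1), C (X j) * (Fin.cons 1 X : Fin (n + 1) → _) j

theorem pderiv_genericForm (i : Fin n) : pderiv i (genericForm K n) = C (X i.succ) := by
  simp [genericForm, Fin.sum_univ_succ, pderiv_X, Pi.single_apply]

theorem aeval_genericForm (ζ : Fin n → K) :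
    (aeval fun j => (C (ζ j) : MvPolynomial (Fin (n + 1)) K)) (genericForm K n) = linForm ζ := by
  simp [genericForm, linForm, Fin.sum_univ_succ, mul_comm]

/-- The form `∑_γ (d choose γ) Λ(y^γ) x^γ` of degree `d` attached to `Λ`. -/
noncomputable def formOf (d : ℕ) : Module.Dual K (MvPolynomial (Fin n) K) →ₗ[K]
    MvPolynomial (Fin (n + 1)) K :=
  (LinearMap.applyₗ' K (genericForm K n ^ d)) ∘ₗ extendScalars

theorem formOf_apply (d : ℕ) (Λ : Module.Dual K (MvPolynomial (Fin n) K)) :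
    formOf d Λ = extendScalars Λ (genericForm K n ^ d) := rfl

theorem formOf_aeval (d : ℕ) (ζ : Fin n → K) :
    formOf d (aeval ζ).toLinearMap = linForm ζ ^ d := by
  rw [formOf_apply, extendScalars_aeval, AlgHom.toLinearMap_apply, map_pow, aeval_genericForm]

/-- Chain rule: the `y_i`-derivative of the generic form is `x_i`. The factor `d` makes the
truncated `d - 1` harmless at `d = 0`. -/
theorem formOf_comp_pderiv (d : ℕ) (Λ : Module.Dual K (MvPolynomial (Fin n) K)) (i : Fin n) :
    formOf d (Λ ∘ₗ (pderiv i).toLinearMap) =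
      (d : MvPolynomial (Fin (n + 1)) K) * X i.succ * formOf (d - 1) Λ := by
  rw [formOf_apply, formOf_apply, extendScalars_comp_pderiv, Derivation.leibniz_pow,
    pderiv_genericForm, ← Nat.cast_smul_eq_nsmul (MvPolynomial (Fin (n + 1)) K), map_smul,
    smul_eq_mul, smul_eq_mul, mul_comm (_ ^ _), ← smul_eq_C_mul, map_smul, smul_eq_mul, mul_assoc]

theorem formOf_comp_pderiv_pow (d : ℕ) (Λ : Module.Dual K (MvPolynomial (Fin n) K)) (i : Fin n)
    (a : ℕ) :
    formOf d (Λ ∘ₗ ((pderiv i).toLinearMap : Module.End K (MvPolynomial (Fin n) K)) ^ a) =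
      (d.descFactorial a : MvPolynomial (Fin (n + 1)) K) * X i.succ ^ a * formOf (d - a) Λ := by
  induction a generalizing d with
  | zero => simp [Module.End.one_eq_id]
  | succ a ih =>
    rw [pow_succ, Module.End.mul_eq_comp, ← LinearMap.comp_assoc, formOf_comp_pderiv, ih,
      Nat.sub_sub, add_comm 1 a]
    cases d with
    | zero => simp
    | succ d =>
      rw [Nat.succ_descFactorial_succ, Nat.add_sub_cancel]
      push_cast
      ring

theorem formOf_comp_listProd (d : ℕ) (Λ : Module.Dual K (MvPolynomial (Fin n) K))
    (α : Fin n →₀ ℕ) (l : List (Fin n)) :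
    formOf d (Λ ∘ₗ (l.map fun i => ((pderiv i).toLinearMap :
        Module.End K (MvPolynomial (Fin n) K)) ^ α i).prod) =
      (d.descFactorial (l.map α).sum : MvPolynomial (Fin (n + 1)) K) *
        (l.map fun i => X i.succ ^ α i).prod *
        formOf (d - (l.map α).sum) Λ := by
  induction l generalizing Λ with
  | nil => simp [Module.End.one_eq_id]
  | cons i l ih =>
    have h := Nat.descFactorial_mul_descFactorial (n := d)
      (Nat.le_add_right (l.map α).sum (α i))
    rw [Nat.add_sub_cancel_left] at h
    rw [List.map_cons, List.prod_cons, Module.End.mul_eq_comp, ← LinearMap.comp_assoc, ih,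
      formOf_comp_pderiv_pow, List.map_cons, List.map_cons, List.sum_cons, List.prod_cons,
      add_comm (α i), Nat.sub_sub, ← h]
    push_cast
    ring

theorem formOf_comp_partialMonomial (d : ℕ) (Λ : Module.Dual K (MvPolynomial (Fin n) K))
    (α : Fin n →₀ ℕ) :
    formOf d (Λ ∘ₗ partialMonomial α) =
      (d.descFactorial α.degree : MvPolynomial (Fin (n + 1)) K) * (∏ i, X i.succ ^ α i) *
        formOf (d - α.degree) Λ := by
  rw [partialMonomial, formOf_comp_listProd, sum_map_finRange, ← List.ofFn_eq_map,
    List.prod_ofFn]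

theorem formOf_evalDiff (d : ℕ) (ζ : Fin n → K) (p : MvPolynomial (Fin n) K) :
    formOf d (evalDiff ζ p) = ∑ α ∈ p.support, C (coeff α p) *
      ((d.descFactorial α.degree : MvPolynomial (Fin (n + 1)) K) * (∏ i, X i.succ ^ α i) *
        linForm ζ ^ (d - α.degree)) := by
  have h : evalDiff ζ p =
      ∑ α ∈ p.support, coeff α p • ((aeval ζ).toLinearMap ∘ₗ partialMonomial α) := by
    refine LinearMap.ext fun g => ?_
    simp [evalDiff, diffOp]
  rw [h, map_sum]
  refine Finset.sum_congr rfl fun α _ => ?_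
  rw [map_smul, formOf_comp_partialMonomial, formOf_aeval, smul_eq_C_mul]

/-! ### Recovering the form -/

/-- Multinomial theorem; `x_0` is paired with `1`, so the `y`-exponent is the tail of the
`x`-exponent. -/
theorem formOf_eq_sum (d : ℕ) (Λ : Module.Dual K (MvPolynomial (Fin n) K)) :
    formOf d Λ = ∑ k ∈ Finset.univ.piAntidiag d,
      monomial (Finsupp.equivFunOnFinite.symm k)
        ((Nat.multinomial Finset.univ k : K) *
          Λ (monomial (Finsupp.equivFunOnFinite.symm k).tail 1)) := by
  rw [formOf_apply, genericForm, Finset.sum_pow_eq_sum_piAntidiag, map_sum]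
  refine Finset.sum_congr rfl fun k _ => ?_
  have h : (Nat.multinomial Finset.univ k : MvPolynomial (Fin n) (MvPolynomial (Fin (n + 1)) K)) *
      ∏ j, (C (X j) * (Fin.cons 1 X : Fin (n + 1) → _) j) ^ k j =
      monomial (Finsupp.equivFunOnFinite.symm k).tail
        ((Nat.multinomial Finset.univ k : MvPolynomial (Fin (n + 1)) K) *
          monomial (Finsupp.equivFunOnFinite.symm k) 1) := by
    rw [monomial_eq, monomial_eq, Finsupp.prod_fintype _ _ (by simp),
      Finsupp.prod_fintype _ _ (by simp)]
    simp only [mul_pow, Finset.prod_mul_distrib]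
    rw [Fin.prod_univ_succ (fun j => (Fin.cons 1 X : Fin (n + 1) → MvPolynomial (Fin n)
      (MvPolynomial (Fin (n + 1)) K)) j ^ k j)]
    simp [mul_assoc, Finsupp.tail_apply]
  rw [h, extendScalars_monomial, mul_right_comm, ← map_natCast C, ← C_mul, C_mul_monomial, mul_one]

theorem coeff_formOf (d : ℕ) (Λ : Module.Dual K (MvPolynomial (Fin n) K)) (γ : Fin (n + 1) →₀ ℕ) :
    coeff γ (formOf d Λ) = if γ.degree = d then
      (Nat.multinomial Finset.univ γ : K) * Λ (monomial γ.tail 1) else 0 := by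
  rw [formOf_eq_sum, coeff_sum]
  simp only [coeff_monomial, Equiv.symm_apply_eq]
  rw [Finset.sum_ite_eq']
  have e : Finsupp.equivFunOnFinite.symm (Finsupp.equivFunOnFinite γ) = γ := by simp
  have e' : Finsupp.equivFunOnFinite γ = ⇑γ := rfl
  rw [e, e', Finsupp.degree_eq_sum]
  simp

theorem degree_eq_add_degree_tail (γ : Fin (n + 1) →₀ ℕ) : γ.degree = γ 0 + γ.tail.degree := by
  simp [Finsupp.degree_eq_sum, Fin.sum_univ_succ, Finsupp.tail_apply]

theorem eq_of_tail_eq_of_degree_eq {γ δ : Fin (n + 1) →₀ ℕ} (ht : γ.tail = δ.tail)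
    (hd : γ.degree = δ.degree) : γ = δ := by
  rw [degree_eq_add_degree_tail, degree_eq_add_degree_tail, ht] at hd
  rw [← Finsupp.cons_tail γ, ← Finsupp.cons_tail δ, ht, Nat.add_right_cancel hd]

theorem dehomogenize_monomial (γ : Fin (n + 1) →₀ ℕ) (a : K) :
    dehomogenize (monomial γ a) = monomial γ.tail a := by
  rw [dehomogenize, aeval_monomial, monomial_eq, Finsupp.prod_fintype _ _ (by simp),
    Finsupp.prod_fintype _ _ (by simp), Fin.prod_univ_succ]
  simp [Finsupp.tail_apply, algebraMap_eq]

/-- Within a fixed degree the tail determines the exponent of `x_0`, so setting `x_0 = 1` merges no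
monomials. -/
theorem coeff_dehomogenize {d : ℕ} {F : MvPolynomial (Fin (n + 1)) K} (hF : F.IsHomogeneous d)
    {γ : Fin (n + 1) →₀ ℕ} (hγ : γ.degree = d) :
    coeff γ.tail (dehomogenize F) = coeff γ F := by
  have h : dehomogenize F = ∑ δ ∈ F.support, monomial δ.tail (coeff δ F) := by
    conv_lhs => rw [F.as_sum, dehomogenize, map_sum]
    exact Finset.sum_congr rfl fun δ _ => dehomogenize_monomial δ _
  rw [h, coeff_sum]
  simp only [coeff_monomial]
  rw [Finset.sum_eq_single γ]
  · simp
  · intro δ hδ hne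
    refine if_neg fun ht => hne (eq_of_tail_eq_of_degree_eq ht ?_)
    rw [hγ, ← hF (mem_support_iff.1 hδ), Finsupp.degree_eq_weight_one]
    rfl
  · simp +contextual

/-- The slack `d - |α|` is exactly the exponent of `x_0`. -/
theorem multiBinom_tail [CharZero K] (γ : Fin (n + 1) →₀ ℕ) :
    (multiBinom γ.degree γ.tail : K) = Nat.multinomial Finset.univ γ := by
  have h0 : ((∏ i, (γ i).factorial : ℕ) : K) ≠ 0 :=
    Nat.cast_ne_zero.2 (Finset.prod_ne_zero_iff.2 fun i _ => Nat.factorial_ne_zero _)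
  have h1 : γ.degree - γ.tail.degree = γ 0 := by
    rw [degree_eq_add_degree_tail, Nat.add_sub_cancel]
  have h2 : ((∏ i, ((γ.tail i).factorial : K)) * ((γ 0).factorial : K)) =
      ((∏ i, (γ i).factorial : ℕ) : K) := by
    rw [Fin.prod_univ_succ, mul_comm]
    push_cast
    rfl
  rw [multiBinom, h1, h2, div_eq_iff h0, mul_comm, ← Nat.cast_mul, Nat.multinomial_spec,
    Finsupp.degree_eq_sum]

theorem dualPoly_apply (d : ℕ) (f : MvPolynomial (Fin n) K)
    (g : restrictTotalDegree (Fin n) K d) :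
    dualPoly d f g =
      ∑ α ∈ f.support, coeff α f / multiBinom d α * coeff α (g : MvPolynomial _ K) := by
  simp [dualPoly]

theorem apply_monomial_of_extends {d : ℕ} {Λ : Module.Dual K (MvPolynomial (Fin n) K)}
    {f : MvPolynomial (Fin n) K} (h : Extends d Λ (dualPoly d f)) {β : Fin n →₀ ℕ}
    (hβ : β.degree ≤ d) : Λ (monomial β 1) = coeff β f / multiBinom d β := by
  have hm : monomial β (1 : K) ∈ restrictTotalDegree (Fin n) K d := by
    rw [mem_restrictTotalDegree]
    exact (totalDegree_monomial_le _ _).trans hβ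
  have := LinearMap.congr_fun h ⟨_, hm⟩
  rw [dualPoly_apply] at this
  refine this.trans ?_
  simp only [coeff_monomial, mul_ite, mul_one, mul_zero]
  rw [Finset.sum_ite_eq]
  split_ifs with hs
  · rfl
  · rw [notMem_support_iff.1 hs, zero_div]

theorem formOf_eq_of_extends [CharZero K] {d : ℕ} {F : MvPolynomial (Fin (n + 1)) K}
    (hF : F.IsHomogeneous d) {Λ : Module.Dual K (MvPolynomial (Fin n) K)}
    (h : Extends d Λ (dualPoly d (dehomogenize F))) : formOf d Λ = F := by
  ext γ
  rw [coeff_formOf]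
  split_ifs with hγ
  · have hle : γ.tail.degree ≤ d := by
      rw [← hγ, degree_eq_add_degree_tail]
      exact Nat.le_add_left _ _
    have h0 : (Nat.multinomial Finset.univ γ : K) ≠ 0 :=
      Nat.cast_ne_zero.2 (Nat.multinomial_pos _ _).ne'
    rw [apply_monomial_of_extends h hle, coeff_dehomogenize hF hγ, ← hγ, multiBinom_tail,
      mul_div_cancel₀ _ h0]
  · refine (hF.coeff_eq_zero fun e => hγ ?_).symm
    exact e

/-! ### The numerators -/

/-- The numerator over a power of the linear form at `ζ`. -/
noncomputable def numerator (d k : ℕ) (ζ : Fin n → K) (p : MvPolynomial (Fin n) K) :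
    MvPolynomial (Fin (n + 1)) K :=
  ∑ α ∈ p.support, C (coeff α p) *
    ((d.descFactorial α.degree : MvPolynomial (Fin (n + 1)) K) * (∏ i, X i.succ ^ α i) *
        linForm ζ ^ (k - 1 - α.degree))

theorem isHomogeneous_linForm (ζ : Fin n → K) : (linForm ζ).IsHomogeneous 1 := by
  refine (isHomogeneous_X _ _).add (IsHomogeneous.sum _ _ _ fun j _ => ?_)
  simpa using (isHomogeneous_C _ (ζ j)).mul (isHomogeneous_X K j.succ)

theorem linForm_ne_zero (ζ : Fin n → K) : linForm ζ ≠ 0 := by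
  intro h
  -- At the point `(1, 0, …, 0)` the form takes the value `1`.
  have := congrArg (aeval (Fin.cons 1 0 : Fin (n + 1) → K)) h
  simp [linForm] at this

theorem degree_add_one_le {p : MvPolynomial (Fin n) K} {k : ℕ} (hk : p.totalDegree + 1 ≤ k)
    {α : Fin n →₀ ℕ} (hα : α ∈ p.support) : α.degree + 1 ≤ k :=
  (Nat.succ_le_succ (le_totalDegree hα)).trans hk

theorem isHomogeneous_numerator (d : ℕ) {k : ℕ} (ζ : Fin n → K) {p : MvPolynomial (Fin n) K}
    (hk : p.totalDegree + 1 ≤ k) : (numerator d k ζ p).IsHomogeneous (k - 1) := by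
  refine IsHomogeneous.sum _ _ _ fun α hα => ?_
  have h := degree_add_one_le hk hα
  have e : 0 + (0 + α.degree + 1 * (k - 1 - α.degree)) = k - 1 := by omega
  refine (congrArg (IsHomogeneous _) e).mp ((isHomogeneous_C _ _).mul
    (((?_ : IsHomogeneous _ 0).mul ?_).mul
    ((isHomogeneous_linForm ζ).pow _)))
  · rw [← map_natCast C]
    exact isHomogeneous_C _ _
  · rw [Finsupp.degree_eq_sum]
    refine IsHomogeneous.prod _ _ _ fun i _ => ?_
    simpa using (isHomogeneous_X K i.succ).pow (α i)

/-- Terms with `|α| > d` vanish through the falling factorial; in the others `k - 1 - |α| ≥ k - (d +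
1)`. -/
theorem linForm_pow_dvd_numerator (d k : ℕ) (ζ : Fin n → K) (p : MvPolynomial (Fin n) K) :
    linForm ζ ^ (k - (d + 1)) ∣ numerator d k ζ p := by
  refine Finset.dvd_sum fun α _ => Dvd.dvd.mul_left ?_ _
  rcases lt_or_ge d α.degree with h | h
  · simp [Nat.descFactorial_of_lt h]
  · exact Dvd.dvd.mul_left (pow_dvd_pow _ (by omega)) _

theorem algebraMap_formOf_evalDiff (d : ℕ) {k : ℕ} (ζ : Fin n → K) {p : MvPolynomial (Fin n) K}
    (hk : p.totalDegree + 1 ≤ k) :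
    algebraMap _ (FractionRing (MvPolynomial (Fin (n + 1)) K)) (formOf d (evalDiff ζ p)) =
      algebraMap _ (FractionRing (MvPolynomial (Fin (n + 1)) K)) (linForm ζ) ^
          ((d : ℤ) - (k : ℤ) + 1) *
        algebraMap _ (FractionRing (MvPolynomial (Fin (n + 1)) K)) (numerator d k ζ p) := by
  have hL : algebraMap _ (FractionRing (MvPolynomial (Fin (n + 1)) K)) (linForm ζ) ≠ 0 :=
    (map_ne_zero_iff _ (IsFractionRing.injective _ _)).2 (linForm_ne_zero ζ)
  rw [formOf_evalDiff, numerator, map_sum, map_sum, Finset.mul_sum]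
  refine Finset.sum_congr rfl fun α hα => ?_
  rcases lt_or_ge d α.degree with h | h
  · simp [Nat.descFactorial_of_lt h]
  · have hα' := degree_add_one_le hk hα
    simp only [map_mul, map_pow]
    rw [← zpow_natCast _ (d - α.degree), ← zpow_natCast _ (k - 1 - α.degree)]
    -- Neither natural subtraction truncates here: `|α| ≤ d` in this case, and `|α| + 1 ≤ k` by the
    -- degree bound.
    have e : ((d - α.degree : ℕ) : ℤ) = ((d : ℤ) - k + 1) + ((k - 1 - α.degree : ℕ) : ℤ) := by
      omega
    rw [e, zpow_add₀ hL]
    ring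

end CactusDecomp

theorem mainTheorem5 {K : Type*} [Field K] [IsAlgClosed K] [CharZero K] {n : ℕ} (hn : 0 < n)
    (d : ℕ) (F : MvPolynomial (Fin (n + 1)) K) (hF : F.IsHomogeneous d)
    (Λ : Module.Dual K (MvPolynomial (Fin n) K))
    (hΛ : CactusDecomp.Extends d Λ (CactusDecomp.dualPoly d (CactusDecomp.dehomogenize F)))
    (s : ℕ) (ζ : Fin s → Fin n → K) (p : Fin s → MvPolynomial (Fin n) K)
    (hdec : CactusDecomp.IsGeneralizedDecomposition Λ ζ p) :
    ∀ k : Fin s → ℕ, (∀ i, (p i).totalDegree + 1 ≤ k i) →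
    (∀ i, CactusDecomp.highestRank Λ (ζ i) ≤ (k i : ℕ∞)) ∧
    ∃ N : Fin s → MvPolynomial (Fin (n + 1)) K,
      (∀ i, (N i).IsHomogeneous (k i - 1)) ∧
      (∀ i, CactusDecomp.linForm (ζ i) ^ (k i - (d + 1)) ∣ N i) ∧
      algebraMap _ (FractionRing (MvPolynomial (Fin (n + 1)) K)) F =
        ∑ i, algebraMap _ (FractionRing (MvPolynomial (Fin (n + 1)) K))
            (CactusDecomp.linForm (ζ i)) ^ ((d : ℤ) - (k i : ℤ) + 1) *
          algebraMap _ (FractionRing (MvPolynomial (Fin (n + 1)) K)) (N i) := by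
  intro k hk
  refine ⟨CactusDecomp.highestRank_le hdec.isPointDecomposition hk,
    fun i => CactusDecomp.numerator d (k i) (ζ i) (p i),
    fun i => CactusDecomp.isHomogeneous_numerator d (ζ i) (hk i),
    fun i => CactusDecomp.linForm_pow_dvd_numerator d (k i) (ζ i) (p i), ?_⟩
  rw [← CactusDecomp.formOf_eq_of_extends hF hΛ, hdec.isPointDecomposition.eq_sum, map_sum, map_sum]
  exact Finset.sum_congr rfl fun i _ => CactusDecomp.algebraMap_formOf_evalDiff d (ζ i) (hk i)
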